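/- **Setting.** Let $\mathbf F:\mathbb R^n\to\mathbb R^n$ be continuous and let $\varphi^t$ be an invertible flow generated by $\dot{\mathbf x}=\mathbf F(\mathbf x)$: it is defined and continuous on an open set $D\subseteq\mathbb R\times\mathbb R^n$ whose sections $\{t:(t,\mathbf x)\in D\}$ are intervals containing $0$; $t\mapsto\varphi^t(\mathbf x)$ solves the equation with $\varphi^0(\mathbf x)=\mathbf x$; and whenever $(s,\mathbf x)\in D$, we have $(t,\varphi^s(\mathbf x))\in D$ if and only if $(t+s,\mathbf x)\in D$, and then $\varphi^{t+s}(\mathbf x)=\varphi^t(\varphi^s(\mathbf x))$. (For a complete flow, $D=\mathbb R\times\mathbb R^n$.) Assume that the flow is nonsingular: for all $t>0$ and all measurable $A$ on which $\varphi^t$ is defined, $\mu(A)\neq0$ implies $\mu(\varphi^t(A))\neq0$, where $\mu$ is the Lebesgue measure. Let $X\subset\mathbb R^n$ be a compact set with $\mu(X)>0$ that is forward invariant ($\varphi^t$ is defined on $X$ and $\varphi^t(X)\subseteq X$ for all $t>0$) or backward invariant ($\varphi^{-t}$ is defined on $X$ and $\varphi^{-t}(X)\subseteq X$ for all $t>0$).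 Let $\mathbf x_1,\mathbf x_2,\dots$ be independent random points, uniformly distributed in $X$, and let $\mathbf y_k=\varphi^{T_s}(\mathbf x_k)$ (no measurement noise). **Algorithm.** Given finitely many basis functions $p_1,\dots,p_N$, with $p_l(\mathbf x)=x_j$ on $X$ for some $l=l(j)$, and $K\ge N$ data pairs, form the $K\times N$ matrices $\mathbf P_{\mathbf x}=(p_i(\mathbf x_k))_{k,i}$ and $\mathbf P_{\mathbf y}=(p_i(\mathbf y_k))_{k,i}$, and set $$\overline{\mathbf L}=\frac1{T_s}\log\big(\mathbf P_{\mathbf x}^\dagger\mathbf P_{\mathbf y}\big),\qquad \hat w_k^j=[\overline{\mathbf L}]_{k\,l(j)},\qquad \hat F_j=\sum_{k=1}^N\hat w_k^j\,p_k,$$ where $\dagger$ is the Moore–Penrose pseudoinverse and $\log$ the principal matrix logarithm. The basis functions are evaluated either as they are or after extension by zero from $X$ to $\mathbb R^n$ (this makes no difference when $X$ is forward invariant); the results hold with either convention. Let $\|\cdot\|$ be the norm of $L^2(X)$. **Theorem.** 1. Let $g_1,g_2,\dots$ be real functions that are continuously differentiable in a neighborhood of each point of $X$, linearly independent in $L^2(X)$,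 with span dense in $L^2(X)$, and such that for each $j$ some $g_{l(j)}$ is the coordinate function $x_j$ on $X$. Use the algorithm with $p_i=g_i$, $1\le i\le N$. Then, with probability one, for every $j=1,\dots,n$, $$\lim_{N\to\infty}\ \lim_{K\to\infty}\ \lim_{T_s\to0^+}\big\|\hat F_j-F_j\big\|=0,$$ where the innermost limit exists for every $N\ge l(j)$ and all sufficiently large $K$ (depending on $N$ and on the sample), and the middle limit exists for every $N\ge l(j)$. 2. Suppose that $\mathbf F=\sum_{k=1}^{N_F}\mathbf w_k\,p_k$, where $p_1,\dots,p_{N_F}$, $N_F=(m_F+n)!/(m_F!\,n!)$, are the monomials of total degree at most $m_F$. Use the algorithm with a basis $p_1,\dots,p_N$ of $N\ge N_F$ distinct monomials that contains $p_1,\dots,p_{N_F}$ and the coordinate functions $x_1,\dots,x_n$. Then, with probability one, for every such basis, every $K\ge N$, every $j=1,\dots,n$ and every $k=1,\dots,N_F$, $$\lim_{T_s\to0^+}\hat w_k^j=w_k^j .$$ -/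

import Mathlib

open MeasureTheory ProbabilityTheory Filter Topology
open scoped ENNReal

namespace Lifting

/-- A flow `φ` generated by `ẋ = F x`, with (maximal) domain of definition `D ⊆ ℝ × ℝⁿ`. The time-`t` map is invertible,
with inverse the time-`(-t)` map. A flow defined for all times and all initial states is the case `D = Set.univ`. -/
structure IsFlow {n : ℕ} (F : EuclideanSpace ℝ (Fin n) → EuclideanSpace ℝ (Fin n))
    (D : Set (ℝ × EuclideanSpace ℝ (Fin n)))
    (φ : ℝ → EuclideanSpace ℝ (Fin n) → EuclideanSpace ℝ (Fin n)) : Prop where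
  isOpen_domain : IsOpen D
  zero_mem : ∀ x, (0, x) ∈ D
  ordConnected : ∀ x, {t : ℝ | (t, x) ∈ D}.OrdConnected
  continuousOn : ContinuousOn (fun p : ℝ × EuclideanSpace ℝ (Fin n) => φ p.1 p.2) D
  hasDerivAt : ∀ t x, (t, x) ∈ D → HasDerivAt (fun s => φ s x) (F (φ t x)) t
  map_zero : ∀ x, φ 0 x = x
  mem_iff : ∀ s t x, (s, x) ∈ D → ((t, φ s x) ∈ D ↔ (t + s, x) ∈ D)
  map_add : ∀ s t x, (s, x) ∈ D → (t + s, x) ∈ D → φ (t + s) x = φ t (φ s x)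

/-- Nonsingularity: for `t > 0`, the map `φ^t` sends sets of positive Lebesgue measure to sets of positive measure. -/
def IsNonsingularFlow {n : ℕ} (D : Set (ℝ × EuclideanSpace ℝ (Fin n)))
    (φ : ℝ → EuclideanSpace ℝ (Fin n) → EuclideanSpace ℝ (Fin n)) : Prop :=
  ∀ t : ℝ, 0 < t → ∀ A : Set (EuclideanSpace ℝ (Fin n)), MeasurableSet A → (∀ x ∈ A, (t, x) ∈ D) →
    volume A ≠ 0 → volume (φ t '' A) ≠ 0

/-- `φ^t(X) ⊆ X` for all `t > 0`. -/
def ForwardInvariant {n : ℕ} (D : Set (ℝ × EuclideanSpace ℝ (Fin n)))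
    (φ : ℝ → EuclideanSpace ℝ (Fin n) → EuclideanSpace ℝ (Fin n))
    (X : Set (EuclideanSpace ℝ (Fin n))) : Prop :=
  ∀ t : ℝ, 0 < t → ∀ x ∈ X, (t, x) ∈ D ∧ φ t x ∈ X

/-- `φ^{-t}(X) ⊆ X` for all `t > 0`. -/
def BackwardInvariant {n : ℕ} (D : Set (ℝ × EuclideanSpace ℝ (Fin n)))
    (φ : ℝ → EuclideanSpace ℝ (Fin n) → EuclideanSpace ℝ (Fin n))
    (X : Set (EuclideanSpace ℝ (Fin n))) : Prop :=
  ∀ t : ℝ, 0 < t → ∀ x ∈ X, (-t, x) ∈ D ∧ φ (-t) x ∈ X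

/-- The four Penrose conditions: `B` is the pseudoinverse of the real matrix `A`. -/
structure IsPseudoinverse {κ ι : Type*} [Fintype κ] [Fintype ι] (A : Matrix κ ι ℝ) (B : Matrix ι κ ℝ) : Prop where
  mul_mul_left : A * B * A = A
  mul_mul_right : B * A * B = B
  symm_left : (A * B).transpose = A * B
  symm_right : (B * A).transpose = B * A

open Classical in
/-- The Moore-Penrose pseudoinverse. -/
noncomputable def pinv {κ ι : Type*} [Fintype κ] [Fintype ι] (A : Matrix κ ι ℝ) : Matrix ι κ ℝ :=
  if h : ∃ B, IsPseudoinverse A B then h.choose else 0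

/-- `L` is the principal logarithm of the real matrix `A`: `exp L = A` and all complex eigenvalues of `L` lie in
the open strip `|Im z| < π`. -/
def IsPrincipalLog {ι : Type*} [Fintype ι] [DecidableEq ι] (A L : Matrix ι ι ℝ) : Prop :=
  NormedSpace.exp L = A ∧ ∀ z ∈ spectrum ℂ (L.map Complex.ofReal), |z.im| < Real.pi

open Classical in
/-- The principal matrix logarithm (with value `0` where it does not exist). -/
noncomputable def matrixLog {ι : Type*} [Fintype ι] [DecidableEq ι] (A : Matrix ι ι ℝ) : Matrix ι ι ℝ :=
  if h : ∃ L, IsPrincipalLog A L then h.choose else 0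

/-- The lifted data matrix: row `k` holds the values of all basis functions at the point `z k`. -/
def liftMatrix {E ι : Type*} {K : ℕ} (p : ι → E → ℝ) (z : Fin K → E) : Matrix (Fin K) ι ℝ :=
  Matrix.of fun k i => p i (z k)

/-- The matrix `(1 / T) log (P_x† P_y)` computed from the snapshot pairs `(x k, y k)` with sampling period `T`. Its
`(k, l)` entry is the estimated coefficient of the basis function `p k` in the `j`-th component of the vector field, when
`p l` is the `j`-th coordinate function. -/
noncomputable def generatorEstimate {E ι : Type*} [Fintype ι] [DecidableEq ι] {K : ℕ} (p : ι → E → ℝ) (T : ℝ)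
    (x y : Fin K → E) : Matrix ι ι ℝ :=
  (1 / T) • matrixLog (pinv (liftMatrix p x) * liftMatrix p y)

/-- The estimated component of the vector field: the combination of the basis functions whose coefficients are the
column `l` of the matrix `generatorEstimate`. -/
noncomputable def fieldEstimate {E ι : Type*} [Fintype ι] [DecidableEq ι] {K : ℕ} (p : ι → E → ℝ) (T : ℝ)
    (x y : Fin K → E) (l : ι) (z : E) : ℝ :=
  ∑ k, generatorEstimate p T x y k l * p k z

/-- The monomial `x ↦ x₁^{s₁} ⋯ xₙ^{sₙ}`. -/
def monomialFun {n : ℕ} (s : Fin n →₀ ℕ) (x : EuclideanSpace ℝ (Fin n)) : ℝ :=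
  ∏ i, x i ^ s i

/-- The exponents `(s₁, …, sₙ)` with `s₁ + ⋯ + sₙ ≤ m`. -/
def exponents (n m : ℕ) : Finset (Fin n →₀ ℕ) :=
  (Finset.range (m + 1)).biUnion fun d => Finset.finsuppAntidiag Finset.univ d

end Lifting

/-! At `T = 0` the data matrices coincide, so if `P_x` has full column rank then `P_x† P_y` starts
at the identity. The logarithm has the identity as its derivative there
(`hasFDerivAt_matrixLog_one`), so the generator estimate tends, as `T → 0+`, to `P_x†` times the
matrix of derivatives of the basis functions along the flow. In the column of the coordinate `x_j`
these derivatives are the values `F_j(x_k)`: the column is the least-squares fit of `F_j` on the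
samples (`tendsto_generatorEstimate_apply`).

For a general basis, the strong law turns the empirical normal equations into the Gram system in
`L²(X)` (`tendsto_pinv_mulVec`). The limit in `K` is the orthogonal projection of `F_j` onto the
span of the first `N` functions, and density finishes (`tendsto_galerkin`). For monomials, `F_j`
lies in the span, so the fit is exact once `P_x` has full column rank. This holds almost surely
because the zero set of a nonzero polynomial is null.

Two points need care. The logarithm is picked by choice among the matrices satisfying a spectral
condition, so it must be shown unique near the identity. With extension by zero, trajectories must
stay in `X` for a short time; for backward invariant `X` this holds almost everywhere by
nonsingularity (`BackwardInvariant.ae_eventually_mem`). -/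

namespace Lifting

/-! ### Principal logarithm near the identity. -/

section MatrixLog

open scoped Matrix.Norms.Operator

variable {ι : Type*} [Fintype ι] [DecidableEq ι]

lemma hasSum_exp_mulVec (M : Matrix ι ι ℂ) (v : ι → ℂ) :
    HasSum (fun k : ℕ => ((k.factorial : ℂ)⁻¹) • ((M ^ k).mulVec v)) ((NormedSpace.exp M).mulVec v) := by
  have h := NormedSpace.exp_series_hasSum_exp' (𝕂 := ℂ) M
  have hc : Continuous fun N : Matrix ι ι ℂ => N.mulVec v := by fun_prop
  have := h.map (Matrix.mulVecBilin ℂ ℂ |>.flip v) hc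
  refine this.congr_fun fun k => ?_
  exact (Matrix.smul_mulVec _ _ _).symm

lemma exp_mulVec_of_eigenvector {M : Matrix ι ι ℂ} {v : ι → ℂ} {μ : ℂ} (h : M.mulVec v = μ • v) :
    (NormedSpace.exp M).mulVec v = Complex.exp μ • v := by
  have hk : ∀ k : ℕ, (M ^ k).mulVec v = μ ^ k • v := by
    intro k
    induction k with
    | zero => simp
    | succ k ih => rw [pow_succ, ← Matrix.mulVec_mulVec, h, Matrix.mulVec_smul, ih, smul_smul, pow_succ, mul_comm]
  have h1 := hasSum_exp_mulVec M v
  have h2 : HasSum (fun k : ℕ => ((k.factorial : ℂ)⁻¹ • μ ^ k) • v) (Complex.exp μ • v) := by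
    rw [Complex.exp_eq_exp_ℂ]
    exact (NormedSpace.exp_series_hasSum_exp' (𝕂 := ℂ) μ).smul_const v
  refine h1.unique ?_
  simpa [hk, smul_smul] using h2

lemma exp_mulVec_of_sq_eq_zero {M : Matrix ι ι ℂ} {v : ι → ℂ} (h : M.mulVec (M.mulVec v) = 0) :
    (NormedSpace.exp M).mulVec v = v + M.mulVec v := by
  have hk : ∀ k : ℕ, (M ^ (k + 2)).mulVec v = 0 := by
    intro k
    rw [pow_add, pow_two, ← Matrix.mulVec_mulVec, ← Matrix.mulVec_mulVec, h, Matrix.mulVec_zero]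
  refine (hasSum_exp_mulVec M v).unique ?_
  have : HasSum (fun k : ℕ => ((k.factorial : ℂ)⁻¹) • ((M ^ k).mulVec v))
      (∑ k ∈ Finset.range 2, ((k.factorial : ℂ)⁻¹) • ((M ^ k).mulVec v)) := by
    refine hasSum_sum_of_ne_finset_zero fun k hk' => ?_
    obtain ⟨m, rfl⟩ : ∃ m, k = m + 2 := ⟨k - 2, by simp at hk'; omega⟩
    simp [hk]
  simpa [Finset.sum_range_succ] using this

lemma mem_spectrum_of_mulVec {M : Matrix ι ι ℂ} {v : ι → ℂ} {μ : ℂ} (hv : v ≠ 0)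
    (h : M.mulVec v = μ • v) : μ ∈ spectrum ℂ M := by
  rw [← Matrix.spectrum_toLin']
  exact (Module.End.hasEigenvalue_of_hasEigenvector
    (x := v) ⟨Module.End.mem_eigenspace_iff.2 (by simpa using h), hv⟩).mem_spectrum

lemma exists_eigenvector_mem {V : Type*} [AddCommGroup V] [Module ℂ V] [FiniteDimensional ℂ V]
    (f : Module.End ℂ V) {p : Submodule ℂ V} (hp : p ≠ ⊥) (hf : ∀ v ∈ p, f v ∈ p) :
    ∃ μ : ℂ, ∃ v ∈ p, v ≠ 0 ∧ f v = μ • v := by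
  have : Nontrivial p := Submodule.nontrivial_iff_ne_bot.2 hp
  obtain ⟨μ, hμ⟩ := Module.End.exists_eigenvalue (f.restrict hf)
  obtain ⟨v, hv⟩ := hμ.exists_hasEigenvector
  refine ⟨μ, v, v.2, fun h => hv.2 (Subtype.ext h), ?_⟩
  simpa using congrArg Subtype.val hv.apply_eq_smul

/-- Commuting complex matrices with spectra in the open strip `|Im z| < π` and equal exponentials coincide. -/
lemma eq_of_exp_eq_of_commute {A B : Matrix ι ι ℂ} (hAB : Commute A B)
    (hA : ∀ z ∈ spectrum ℂ A, |z.im| < Real.pi) (hB : ∀ z ∈ spectrum ℂ B, |z.im| < Real.pi)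
    (h : NormedSpace.exp A = NormedSpace.exp B) : A = B := by
  set C := A - B with hC
  have hCB : Commute C B := hAB.sub_left (Commute.refl B)
  have hexp : NormedSpace.exp C = 1 := by
    have h1 : NormedSpace.exp A = NormedSpace.exp C * NormedSpace.exp B := by
      rw [← Matrix.exp_add_of_commute _ _ hCB]; simp [hC]
    have hu := Matrix.isUnit_exp B
    rw [h] at h1
    exact (hu.mul_eq_right.1 h1.symm)
  by_contra hne
  -- The common eigenvector of `C` and `B` is sought inside the range of `C`: writing it as `w = C
  -- u` later rules out a nilpotent part of `C`.
  have hp : LinearMap.range C.mulVecLin ≠ ⊥ := by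
    intro hb
    rw [LinearMap.range_eq_bot] at hb
    have : C = 0 := by
      apply Matrix.toLin'.injective
      rw [map_zero]
      exact hb
    exact hne (sub_eq_zero.1 this)
  obtain ⟨μ, v, hv, hv0, hvμ⟩ := exists_eigenvector_mem C.mulVecLin hp (fun v _ => ⟨v, rfl⟩)
  have hp' : LinearMap.range C.mulVecLin ⊓ Module.End.eigenspace C.mulVecLin μ ≠ ⊥ := by
    intro hb
    apply hv0
    rw [← Submodule.mem_bot ℂ, ← hb]
    exact ⟨hv, Module.End.mem_eigenspace_iff.2 hvμ⟩
  obtain ⟨ν, w, ⟨⟨u, hu⟩, hwμ⟩, hw0, hwν⟩ := exists_eigenvector_mem B.mulVecLin hp' (by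
    rintro v ⟨⟨u, rfl⟩, hv⟩
    rw [SetLike.mem_coe, Module.End.mem_eigenspace_iff] at hv
    simp only [Matrix.mulVecLin_apply] at hv
    refine ⟨⟨B.mulVec u, ?_⟩, ?_⟩
    · simp [hCB.eq]
    · rw [SetLike.mem_coe, Module.End.mem_eigenspace_iff]
      simp only [Matrix.mulVecLin_apply]
      rw [Matrix.mulVec_mulVec, hCB.eq, ← Matrix.mulVec_mulVec, hv, Matrix.mulVec_smul])
  rw [SetLike.mem_coe, Module.End.mem_eigenspace_iff] at hwμ
  simp only [Matrix.mulVecLin_apply] at hwμ hwν hu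
  have hwA : A.mulVec w = (μ + ν) • w := by
    have : A = C + B := by simp [hC]
    rw [this, Matrix.add_mulVec, hwμ, hwν, add_smul]
  have h1 := hA _ (mem_spectrum_of_mulVec hw0 hwA)
  have h2 := hB _ (mem_spectrum_of_mulVec hw0 hwν)
  have h3 := exp_mulVec_of_eigenvector hwμ
  rw [hexp, Matrix.one_mulVec] at h3
  have h4 : Complex.exp μ = 1 := by
    by_contra hn
    have : (Complex.exp μ - 1) • w = 0 := by rw [sub_smul, ← h3, one_smul, sub_self]
    rcases smul_eq_zero.1 this with h | h
    · exact hn (sub_eq_zero.1 h)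
    · exact hw0 h
  have hμ0 : μ = 0 := by
    obtain ⟨m, hm⟩ := Complex.exp_eq_one_iff.1 h4
    have him : μ.im = m * (2 * Real.pi) := by rw [hm]; simp
    have hlt : |μ.im| < 2 * Real.pi := by
      have : μ.im = (μ + ν).im - ν.im := by simp
      rw [this]
      calc _ ≤ |(μ + ν).im| + |ν.im| := abs_sub _ _
        _ < 2 * Real.pi := by linarith
    have hm0 : m = 0 := by
      rw [him, abs_mul, abs_of_pos Real.two_pi_pos] at hlt
      have : |(m : ℝ)| < 1 := by
        by_contra hge
        push Not at hge
        nlinarith [Real.pi_pos]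
      exact Int.abs_lt_one_iff.1 (by exact_mod_cast this)
    simp [hm, hm0]
  -- Now `C (C u) = 0`, so the exponential series on `u` stops at `u + C u`. As `exp C = 1`, this
  -- forces `w = C u = 0`.
  rw [hμ0, zero_smul, ← hu] at hwμ
  have h5 := exp_mulVec_of_sq_eq_zero hwμ
  rw [hexp, Matrix.one_mulVec, hu] at h5
  exact hw0 (by simpa using h5)

lemma norm_map_ofReal (A : Matrix ι ι ℝ) : ‖A.map Complex.ofReal‖ = ‖A‖ := by
  simp [Matrix.linfty_opNorm_def]

lemma abs_im_lt_of_norm_lt {A : Matrix ι ι ℝ} (hA : ‖A‖ < Real.pi) :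
    ∀ z ∈ spectrum ℂ (A.map Complex.ofReal), |z.im| < Real.pi := by
  intro z hz
  rcases isEmpty_or_nonempty ι with h | h
  · have : Subsingleton (Matrix ι ι ℂ) := inferInstance
    simp [spectrum.of_subsingleton] at hz
  · have := spectrum.norm_le_norm_of_mem hz
    rw [norm_map_ofReal] at this
    exact (Complex.abs_im_le_norm z).trans_lt (this.trans_lt hA)

lemma exp_map_ofReal (A : Matrix ι ι ℝ) :
    NormedSpace.exp (A.map Complex.ofReal) = (NormedSpace.exp A).map Complex.ofReal := by
  have hc : Continuous (Complex.ofRealHom.mapMatrix : Matrix ι ι ℝ →+* Matrix ι ι ℂ) :=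
    continuous_id.matrix_map Complex.continuous_ofReal
  exact (NormedSpace.map_exp (Complex.ofRealHom.mapMatrix : Matrix ι ι ℝ →+* Matrix ι ι ℂ) hc A).symm

/-- Near `0`, the exponential has a unique preimage among matrices that satisfy the principal spectral condition. -/
lemma exists_forall_isPrincipalLog_eq : ∀ᶠ L in 𝓝 (0 : Matrix ι ι ℝ),
    IsPrincipalLog (NormedSpace.exp L) L ∧ ∀ L', IsPrincipalLog (NormedSpace.exp L) L' → L' = L := by
  have hs : HasStrictFDerivAt (NormedSpace.exp : Matrix ι ι ℝ → Matrix ι ι ℝ)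
      ((ContinuousLinearEquiv.refl ℝ (Matrix ι ι ℝ) : Matrix ι ι ℝ ≃L[ℝ] Matrix ι ι ℝ) :
        Matrix ι ι ℝ →L[ℝ] Matrix ι ι ℝ) 0 := hasStrictFDerivAt_exp_zero
  have hinj := hs.eventually_left_inverse
  have hball : ∀ᶠ L in 𝓝 (0 : Matrix ι ι ℝ), ‖L‖ < Real.pi := by
    have : Metric.ball (0 : Matrix ι ι ℝ) Real.pi ∈ 𝓝 0 := Metric.ball_mem_nhds _ Real.pi_pos
    filter_upwards [this] with L hL
    simpa using hL
  -- The left inverse is needed on a whole neighborhood of `L`, since it is applied to conjugates of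
  -- `L`.
  filter_upwards [hinj.eventually_nhds, hball] with L hL hLn
  have hpr : IsPrincipalLog (NormedSpace.exp L) L := ⟨rfl, abs_im_lt_of_norm_lt hLn⟩
  refine ⟨hpr, fun L' hL' => ?_⟩
  -- `1 + s L'` commutes with `exp L' = exp L`, so conjugating `L` by it gives another logarithm of
  -- `exp L`, close to `L` for small `s`. Local injectivity makes the two equal, and any such `s ≠
  -- 0` gives commutation with `L'`, however large `L'` is.
  have hcomm : Commute L' L := by
    have hexp : Commute L' (NormedSpace.exp L) := by
      rw [← hL'.1]; exact (Commute.refl L').exp_right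
    have hU : Tendsto (fun s : ℝ => (1 + s • L')) (𝓝 0) (𝓝 1) := by
      have : Continuous (fun s : ℝ => (1 + s • L')) := by fun_prop
      simpa using this.tendsto 0
    have hdet : ∀ᶠ s in 𝓝 (0 : ℝ), IsUnit (1 + s • L') :=
      hU.eventually (Units.isOpen.mem_nhds isUnit_one)
    have hinvc : Tendsto (fun s : ℝ => (1 + s • L') * L * (1 + s • L')⁻¹) (𝓝 0) (𝓝 L) := by
      have h1 : Tendsto (fun s : ℝ => (1 + s • L')⁻¹) (𝓝 0) (𝓝 1) := by
        have := (NormedRing.inverse_continuousAt (1 : (Matrix ι ι ℝ)ˣ)).tendsto.comp hU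
        rw [Units.val_one, Ring.inverse_one] at this
        simp only [Matrix.nonsing_inv_eq_ringInverse]
        exact this
      simpa using (hU.mul_const L).mul h1
    have hne : ∀ᶠ s in 𝓝[≠] (0 : ℝ), Commute (1 + s • L') L ∧ s ≠ 0 := by
      filter_upwards [hdet.filter_mono nhdsWithin_le_nhds,
        (hinvc.eventually hL).filter_mono nhdsWithin_le_nhds, self_mem_nhdsWithin] with s hs1 hs2 hs3
      refine ⟨?_, hs3⟩
      have hsu := (Matrix.isUnit_iff_isUnit_det _).1 hs1
      have hc1 : Commute (1 + s • L') (NormedSpace.exp L) :=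
        (Commute.one_left _).add_left (hexp.smul_left s)
      have h1 : NormedSpace.exp ((1 + s • L') * L * (1 + s • L')⁻¹) = NormedSpace.exp L := by
        rw [Matrix.exp_conj _ _ hs1, hc1.eq, Matrix.mul_assoc, Matrix.mul_nonsing_inv _ hsu, Matrix.mul_one]
      rw [h1, hL.self_of_nhds] at hs2
      have h2 : (1 + s • L') * L = L * (1 + s • L') := by
        conv_rhs => rw [hs2]
        rw [Matrix.mul_assoc ((1 + s • L') * L), Matrix.nonsing_inv_mul _ hsu, Matrix.mul_one]
      exact h2
    obtain ⟨s, hs1, hs0⟩ := hne.exists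
    have h3 : Commute (s • L') L := by
      simpa using hs1.sub_left (Commute.one_left L)
    simpa [hs0, smul_smul] using h3.smul_left s⁻¹
  have hcomm' : Commute (L'.map Complex.ofReal) (L.map Complex.ofReal) :=
    hcomm.map (Complex.ofRealHom.mapMatrix : Matrix ι ι ℝ →+* Matrix ι ι ℂ)
  have := eq_of_exp_eq_of_commute hcomm' hL'.2 hpr.2 (by rw [exp_map_ofReal, exp_map_ofReal, hL'.1])
  exact Matrix.map_injective Complex.ofReal_injective this

lemma matrixLog_exp_eventually : ∀ᶠ L in 𝓝 (0 : Matrix ι ι ℝ), matrixLog (NormedSpace.exp L) = L := by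
  filter_upwards [exists_forall_isPrincipalLog_eq (ι := ι)] with L hL
  have h : ∃ L', IsPrincipalLog (NormedSpace.exp L) L' := ⟨L, hL.1⟩
  rw [matrixLog, dif_pos h]
  exact hL.2 _ h.choose_spec

/-- Near `1` the logarithm agrees with the local inverse of `exp` at `0`, where the derivative of
`exp` is the identity. -/
lemma hasFDerivAt_matrixLog_one :
    HasFDerivAt (matrixLog : Matrix ι ι ℝ → Matrix ι ι ℝ) (ContinuousLinearMap.id ℝ (Matrix ι ι ℝ)) 1 ∧
      matrixLog (1 : Matrix ι ι ℝ) = 0 := by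
  have hs : HasStrictFDerivAt (NormedSpace.exp : Matrix ι ι ℝ → Matrix ι ι ℝ)
      ((ContinuousLinearEquiv.refl ℝ (Matrix ι ι ℝ) : Matrix ι ι ℝ ≃L[ℝ] Matrix ι ι ℝ) :
        Matrix ι ι ℝ →L[ℝ] Matrix ι ι ℝ) 0 := hasStrictFDerivAt_exp_zero
  have h1 := hs.to_localInverse.hasFDerivAt
  have h2 := hs.localInverse_unique matrixLog_exp_eventually
  rw [NormedSpace.exp_zero] at h1 h2
  refine ⟨h1.congr_of_eventuallyEq h2, ?_⟩
  have := (matrixLog_exp_eventually (ι := ι)).self_of_nhds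
  simpa using this

lemma tendsto_matrixLog_div {M : ℝ → Matrix ι ι ℝ} {A : Matrix ι ι ℝ}
    (hM : Tendsto (fun T : ℝ => (1 / T) • (M T - 1)) (𝓝[>] 0) (𝓝 A)) (h0 : M 0 = 1) :
    Tendsto (fun T : ℝ => (1 / T) • matrixLog (M T)) (𝓝[>] 0) (𝓝 A) := by
  obtain ⟨h1, h2⟩ := hasFDerivAt_matrixLog_one (ι := ι)
  have hM' : HasDerivWithinAt M A (Set.Ioi 0) 0 := by
    have hsl : Tendsto (slope M 0) (𝓝[>] 0) (𝓝 A) := by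
      refine hM.congr fun T => ?_
      simp [slope_def_module, h0]
    exact (hasDerivWithinAt_iff_tendsto_slope' (s := Set.Ioi (0 : ℝ)) (by simp)).2 hsl
  rw [← h0] at h1
  have h3 := h1.comp_hasDerivWithinAt 0 hM'
  rw [hasDerivWithinAt_iff_tendsto_slope' (by simp)] at h3
  refine h3.congr fun T => ?_
  simp [slope_def_module, h0, h2]

lemma tendsto_matrix_inv {α : Type*} {f : Filter α} {M : α → Matrix ι ι ℝ} {A : Matrix ι ι ℝ}
    (hM : Tendsto M f (𝓝 A)) (hA : IsUnit A) : Tendsto (fun a => (M a)⁻¹) f (𝓝 A⁻¹) := by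
  obtain ⟨u, rfl⟩ := hA
  have := (NormedRing.inverse_continuousAt u).tendsto.comp hM
  simp only [Matrix.nonsing_inv_eq_ringInverse]
  exact this

end MatrixLog

/-! ### Pseudoinverse at full column rank. -/

section Pseudoinverse

variable {κ ι : Type*} [Fintype κ] [Fintype ι] [DecidableEq ι]

-- The formula satisfies the four Penrose conditions. Conversely `A B A = A` and the symmetry of `A
-- B` already give the normal equations `Aᵀ A B = Aᵀ`, which determine `B`.
open Matrix in
lemma pinv_eq {A : Matrix κ ι ℝ} (h : IsUnit (Aᵀ * A)) : pinv A = (Aᵀ * A)⁻¹ * Aᵀ := by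
  have hd := (Matrix.isUnit_iff_isUnit_det _).1 h
  have hinv : (Aᵀ * A)⁻¹ * Aᵀ * A = 1 := by rw [Matrix.mul_assoc, nonsing_inv_mul _ hd]
  have hex : ∃ B, IsPseudoinverse A B := by
    refine ⟨(Aᵀ * A)⁻¹ * Aᵀ, ?_, ?_, ?_, ?_⟩
    · rw [Matrix.mul_assoc, hinv, Matrix.mul_one]
    · rw [hinv, Matrix.one_mul]
    · simp only [transpose_mul, transpose_nonsing_inv, transpose_transpose, Matrix.mul_assoc]
    · rw [hinv, transpose_one]
  rw [pinv, dif_pos hex]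
  set B := hex.choose with hB
  have hp : IsPseudoinverse A B := hex.choose_spec
  have hBA : B * A = 1 := by
    calc B * A = ((Aᵀ * A)⁻¹ * Aᵀ * A) * (B * A) := by rw [hinv, Matrix.one_mul]
      _ = (Aᵀ * A)⁻¹ * Aᵀ * (A * B * A) := by simp only [Matrix.mul_assoc]
      _ = 1 := by rw [hp.mul_mul_left, hinv]
  have h2 : Aᵀ * A * B = Aᵀ := by
    calc Aᵀ * A * B = Aᵀ * (A * B)ᵀ := by rw [hp.symm_left, Matrix.mul_assoc]
      _ = (A * B * A)ᵀ := (transpose_mul _ _).symm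
      _ = Aᵀ := by rw [hp.mul_mul_left]
  calc B = (Aᵀ * A)⁻¹ * (Aᵀ * A * B) := by rw [← Matrix.mul_assoc, nonsing_inv_mul _ hd, Matrix.one_mul]
    _ = _ := by rw [h2]

open Matrix in
lemma pinv_mul_self {A : Matrix κ ι ℝ} (h : IsUnit (Aᵀ * A)) : pinv A * A = 1 := by
  rw [pinv_eq h, Matrix.mul_assoc, nonsing_inv_mul _ ((Matrix.isUnit_iff_isUnit_det _).1 h)]

open Matrix in
lemma isUnit_transpose_mul_self {A : Matrix κ ι ℝ} (h : Function.Injective A.mulVec) : IsUnit (Aᵀ * A) := by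
  have := (Matrix.PosDef.conjTranspose_mul_self A h).isUnit
  simpa [conjTranspose_eq_transpose_of_trivial] using this

/-- Small sampling period limit of the estimated generator, in terms of the one-sided derivatives of the
basis functions along the trajectories. -/
lemma tendsto_generatorEstimate {E : Type*} {K : ℕ} {p : ι → E → ℝ} {x : Fin K → E} {y : ℝ → Fin K → E}
    {Q : Matrix (Fin K) ι ℝ} (h : IsUnit ((liftMatrix p x).transpose * liftMatrix p x)) (hy : y 0 = x)
    (hQ : ∀ k i, Tendsto (fun T : ℝ => (1 / T) * (p i (y T k) - p i (x k))) (𝓝[>] 0) (𝓝 (Q k i))) :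
    Tendsto (fun T : ℝ => generatorEstimate p T x (y T)) (𝓝[>] 0) (𝓝 (pinv (liftMatrix p x) * Q)) := by
  refine tendsto_matrixLog_div ?_ (by rw [hy, pinv_mul_self h])
  have h1 : Tendsto (fun T : ℝ => (1 / T) • (liftMatrix p (y T) - liftMatrix p x)) (𝓝[>] 0) (𝓝 Q) := by
    refine tendsto_pi_nhds.2 fun k => tendsto_pi_nhds.2 fun i => ?_
    simpa [liftMatrix] using hQ k i
  have hc : Continuous fun R : Matrix (Fin K) ι ℝ => pinv (liftMatrix p x) * R := by fun_prop
  refine ((hc.tendsto Q).comp h1).congr fun T => ?_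
  simp only [Function.comp_apply]
  rw [Matrix.mul_smul, Matrix.mul_sub, pinv_mul_self h]

end Pseudoinverse

/-! ### Flow, invariant sets and derivatives along trajectories. -/

section Flow

variable {n : ℕ} {F : EuclideanSpace ℝ (Fin n) → EuclideanSpace ℝ (Fin n)}
    {D : Set (ℝ × EuclideanSpace ℝ (Fin n))}
    {φ : ℝ → EuclideanSpace ℝ (Fin n) → EuclideanSpace ℝ (Fin n)}
    {X : Set (EuclideanSpace ℝ (Fin n))}

lemma IsFlow.isOpen_section (hφ : IsFlow F D φ) (t : ℝ) : IsOpen {z | (t, z) ∈ D} :=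
  hφ.isOpen_domain.preimage (by fun_prop : Continuous fun z : EuclideanSpace ℝ (Fin n) => (t, z))

lemma IsFlow.continuousOn_section (hφ : IsFlow F D φ) (t : ℝ) : ContinuousOn (φ t) {z | (t, z) ∈ D} :=
  hφ.continuousOn.comp (f := fun z => (t, z)) (by fun_prop) (fun _ hz => hz)

lemma IsFlow.measurableSet_preimage (hφ : IsFlow F D φ) (t : ℝ) {A : Set (EuclideanSpace ℝ (Fin n))}
    (hA : MeasurableSet A) : MeasurableSet {z | (t, z) ∈ D ∧ φ t z ∈ A} := by
  have hU := (hφ.isOpen_section t).measurableSet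
  have h := (continuousOn_iff_continuous_domRestrict.1 (hφ.continuousOn_section t)).measurable hA
  have := hU.subtype_image h
  convert this using 1
  ext z
  simp [and_comm]

lemma IsFlow.neg_mem (hφ : IsFlow F D φ) {t : ℝ} {z : EuclideanSpace ℝ (Fin n)} (h : (t, z) ∈ D) :
    (-t, φ t z) ∈ D := by
  rw [hφ.mem_iff t (-t) z h, neg_add_cancel]
  exact hφ.zero_mem z

lemma IsFlow.map_neg (hφ : IsFlow F D φ) {t : ℝ} {z : EuclideanSpace ℝ (Fin n)} (h : (t, z) ∈ D) :
    φ (-t) (φ t z) = z := by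
  rw [← hφ.map_add t (-t) z h (by rw [neg_add_cancel]; exact hφ.zero_mem z), neg_add_cancel, hφ.map_zero]

/-- Invertibility makes a forward image a preimage under the inverse map, hence measurable for
measurable `A`. -/
lemma IsFlow.image_eq (hφ : IsFlow F D φ) {t : ℝ} {A : Set (EuclideanSpace ℝ (Fin n))}
    (hA : ∀ z ∈ A, (t, z) ∈ D) : φ t '' A = {z | (-t, z) ∈ D ∧ φ (-t) z ∈ A} := by
  ext y
  constructor
  · rintro ⟨z, hz, rfl⟩
    exact ⟨hφ.neg_mem (hA z hz), by rwa [hφ.map_neg (hA z hz)]⟩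
  · rintro ⟨hy, hyA⟩
    refine ⟨_, hyA, ?_⟩
    have := hφ.map_neg hy
    rwa [neg_neg] at this

lemma IsFlow.mem_of_le (hφ : IsFlow F D φ) {s t : ℝ} {z : EuclideanSpace ℝ (Fin n)} (h : (t, z) ∈ D)
    (hs : 0 ≤ s) (hst : s ≤ t) : (s, z) ∈ D :=
  (hφ.ordConnected z).out (hφ.zero_mem z) h ⟨hs, hst⟩

lemma IsFlow.hasDerivAt_zero (hφ : IsFlow F D φ) (z : EuclideanSpace ℝ (Fin n)) :
    HasDerivAt (fun t => φ t z) (F z) 0 := by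
  simpa [hφ.map_zero] using hφ.hasDerivAt 0 z (hφ.zero_mem z)

/-- A backward invariant set contains the earlier part of any trajectory that starts in the set and
returns to it. -/
lemma BackwardInvariant.mem_of_le (hφ : IsFlow F D φ) (hX : BackwardInvariant D φ X) {s t : ℝ}
    {z : EuclideanSpace ℝ (Fin n)} (h : (t, z) ∈ D) (hz : φ t z ∈ X) (hs : 0 ≤ s) (hst : s ≤ t) :
    φ s z ∈ X := by
  rcases hst.eq_or_lt with rfl | hlt
  · exact hz
  · have h1 := (hX (t - s) (by linarith) _ hz).2
    rwa [← hφ.map_add t (-(t - s)) z h, show -(t - s) + t = s by ring] at h1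
    rw [show -(t - s) + t = s by ring]
    exact hφ.mem_of_le h hs hst

/-- Almost every point of a backward invariant set stays in the set for a short time. -/
lemma BackwardInvariant.ae_eventually_mem (hφ : IsFlow F D φ) (hns : IsNonsingularFlow D φ)
    (hXm : MeasurableSet X) (hX : BackwardInvariant D φ X) :
    ∀ᵐ z ∂volume.restrict X, ∀ᶠ t in 𝓝[>] (0 : ℝ), φ t z ∈ X := by
  set u : ℕ → ℝ := fun m => 1 / ((m : ℝ) + 1) with hu
  have hupos : ∀ m, 0 < u m := fun m => Nat.one_div_pos_of_nat
  have hu0 : Tendsto u atTop (𝓝 0) := tendsto_one_div_add_atTop_nhds_zero_nat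
  -- By `BackwardInvariant.mem_of_le`, testing the countably many times `u m` detects every point
  -- that is in `X` at some positive time; countability keeps `B` measurable.
  set B : Set (EuclideanSpace ℝ (Fin n)) := X \ ⋃ m, {z | (u m, z) ∈ D ∧ φ (u m) z ∈ X} with hB
  have hBm : MeasurableSet B :=
    hXm.diff (MeasurableSet.iUnion fun m => hφ.measurableSet_preimage (u m) hXm)
  have hBexit : ∀ z ∈ B, ∀ t, 0 < t → (t, z) ∈ D → φ t z ∉ X := by
    intro z hz t ht hD hmem
    obtain ⟨m, hm⟩ := (hu0.eventually (gt_mem_nhds ht)).exists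
    refine hz.2 (Set.mem_iUnion.2 ⟨m, hφ.mem_of_le hD (hupos m).le hm.le, ?_⟩)
    exact hX.mem_of_le hφ hD hmem (hupos m).le hm.le
  have hBnull : volume B = 0 := by
    by_contra hne
    have hcov : B ⊆ ⋃ m, B ∩ {z | (u m, z) ∈ D} := by
      intro z hz
      have h1 : Tendsto (fun m => (u m, z)) atTop (𝓝 (0, z)) :=
        hu0.prodMk_nhds tendsto_const_nhds
      obtain ⟨m, hm⟩ := (h1.eventually (hφ.isOpen_domain.mem_nhds (hφ.zero_mem z))).exists
      exact Set.mem_iUnion.2 ⟨m, hz, hm⟩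
    obtain ⟨m, hm⟩ : ∃ m, volume (B ∩ {z | (u m, z) ∈ D}) ≠ 0 := by
      by_contra! hall
      exact hne (measure_mono_null hcov (measure_iUnion_null hall))
    set C := B ∩ {z | (u m, z) ∈ D} with hC
    have hCm : MeasurableSet C := hBm.inter (hφ.isOpen_section _).measurableSet
    have hCD : ∀ s : Set.Ioo 0 (u m), ∀ z ∈ C, ((s : ℝ), z) ∈ D := fun s z hz =>
      hφ.mem_of_le hz.2 s.2.1.le s.2.2.le
    -- If `φ^s b = φ^t b'`, then `φ^(t-s) b' = b` lies in `X`, but points of `B` are never in `X` at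
    -- a positive time. Nonsingularity then yields uncountably many disjoint sets of positive
    -- measure, which is impossible.
    have hdisj : ∀ s t : Set.Ioo 0 (u m), (s : ℝ) < t → Disjoint (φ s '' C) (φ t '' C) := by
      intro s t hst
      rw [Set.disjoint_left]
      rintro _ ⟨b, hb, rfl⟩ ⟨b', hb', heq⟩
      have hmem : ((t : ℝ) - s, b') ∈ D :=
        hφ.mem_of_le (hCD t b' hb') (by linarith) (by linarith [s.2.1])
      have h1 : φ ((t : ℝ) - s) b' = b := by
        have h2 := hφ.map_add t (-(s : ℝ)) b' (hCD t b' hb')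
          (by rwa [show -(s : ℝ) + t = t - s by ring])
        rw [heq, hφ.map_neg (hCD s b hb)] at h2
        rwa [show -(s : ℝ) + t = t - s by ring] at h2
      refine hBexit b' hb'.1 _ (by linarith) hmem ?_
      rw [h1]
      exact hb.1.1
    have hcount := Measure.countable_meas_pos_of_disjoint_iUnion (μ := volume)
      (As := fun s : Set.Ioo 0 (u m) => φ s '' C)
      (fun s => by
        rw [hφ.image_eq (hCD s)]
        exact hφ.measurableSet_preimage _ hCm)
      (fun s t hst => by
        rcases lt_or_gt_of_ne (fun h => hst (Subtype.ext h) : (s : ℝ) ≠ t) with h | h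
        · exact hdisj s t h
        · exact (hdisj t s h).symm)
    have huniv : {s : Set.Ioo 0 (u m) | 0 < volume (φ s '' C)} = Set.univ := by
      ext s
      simpa [pos_iff_ne_zero] using hns s s.2.1 C hCm (hCD s) hm
    rw [huniv, Set.countable_univ_iff, Set.countable_coe_iff] at hcount
    have := (Cardinal.Real.Ioo_countable_iff).1 hcount
    exact absurd (hupos m) (not_lt.2 this)
  rw [ae_restrict_iff' hXm]
  filter_upwards [compl_mem_ae_iff.2 hBnull] with z hz hzX
  have : z ∈ ⋃ m, {z | (u m, z) ∈ D ∧ φ (u m) z ∈ X} := by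
    by_contra h
    exact hz ⟨hzX, h⟩
  obtain ⟨m, hm, hmX⟩ := Set.mem_iUnion.1 this
  filter_upwards [Ioo_mem_nhdsGT (hupos m)] with t ht
  exact hX.mem_of_le hφ hm hmX ht.1.le ht.2.le

lemma ae_eventually_mem_of_invariant (hφ : IsFlow F D φ) (hns : IsNonsingularFlow D φ)
    (hXm : MeasurableSet X) (hX : ForwardInvariant D φ X ∨ BackwardInvariant D φ X) :
    ∀ᵐ z ∂volume.restrict X, ∀ᶠ t in 𝓝[>] (0 : ℝ), φ t z ∈ X := by
  rcases hX with hX | hX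
  · rw [ae_restrict_iff' hXm]
    refine Eventually.of_forall fun z hz => ?_
    filter_upwards [self_mem_nhdsWithin] with t ht
    exact (hX t ht z hz).2
  · exact hX.ae_eventually_mem hφ hns hXm

lemma IsFlow.hasDerivAt_comp (hφ : IsFlow F D φ) {g : EuclideanSpace ℝ (Fin n) → ℝ}
    {z : EuclideanSpace ℝ (Fin n)} (hg : DifferentiableAt ℝ g z) :
    HasDerivAt (fun t => g (φ t z)) (fderiv ℝ g z (F z)) 0 := by
  have h1 : HasFDerivAt g (fderiv ℝ g z) (φ 0 z) := by
    rw [hφ.map_zero]; exact hg.hasFDerivAt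
  exact h1.comp_hasDerivAt 0 (hφ.hasDerivAt_zero z)

/-- On an invariant set, the Lie derivative of a function that agrees there with the `j`-th coordinate is
the `j`-th component of the vector field. -/
lemma IsFlow.fderiv_apply_of_eqOn_coord (hφ : IsFlow F D φ)
    (hX : ForwardInvariant D φ X ∨ BackwardInvariant D φ X) {g : EuclideanSpace ℝ (Fin n) → ℝ} {j : Fin n}
    (hgj : ∀ z ∈ X, g z = z j) {z : EuclideanSpace ℝ (Fin n)} (hz : z ∈ X) (hg : DifferentiableAt ℝ g z) :
    fderiv ℝ g z (F z) = F z j := by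
  have h1 := hφ.hasDerivAt_comp hg
  have h2 : HasDerivAt (fun t => (φ t z) j) (F z j) 0 :=
    ((EuclideanSpace.proj j : EuclideanSpace ℝ (Fin n) →L[ℝ] ℝ).hasFDerivAt.comp_hasDerivAt 0
      (hφ.hasDerivAt_zero z))
  have h00 : φ 0 z ∈ X := by rwa [hφ.map_zero]
  -- The trajectory is known to stay in `X` on one side of time `0` only; both derivatives exist, so
  -- comparing one-sided derivatives suffices.
  rcases hX with hX | hX
  · have heq : ∀ t ∈ Set.Ici (0 : ℝ), g (φ t z) = (φ t z) j := by
      intro t ht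
      rcases (Set.mem_Ici.1 ht).eq_or_lt with rfl | ht
      · exact hgj _ h00
      · exact hgj _ (hX t ht z hz).2
    exact (uniqueDiffWithinAt_Ici 0).eq_deriv _ (h1.hasDerivWithinAt)
      (h2.hasDerivWithinAt.congr heq (heq 0 (by simp)))
  · have heq : ∀ t ∈ Set.Iic (0 : ℝ), g (φ t z) = (φ t z) j := by
      intro t ht
      rcases (Set.mem_Iic.1 ht).eq_or_lt with rfl | ht
      · exact hgj _ h00
      · have := (hX (-t) (by linarith) z hz).2
        rw [neg_neg] at this
        exact hgj _ this
    exact (uniqueDiffWithinAt_Iic 0).eq_deriv _ (h1.hasDerivWithinAt)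
      (h2.hasDerivWithinAt.congr heq (heq 0 (by simp)))

lemma eq_apply_of_mem {ρ : (EuclideanSpace ℝ (Fin n) → ℝ) → EuclideanSpace ℝ (Fin n) → ℝ}
    (hρ : ρ = id ∨ ρ = X.indicator) (g : EuclideanSpace ℝ (Fin n) → ℝ) {z : EuclideanSpace ℝ (Fin n)}
    (hz : z ∈ X) : ρ g z = g z := by
  rcases hρ with rfl | rfl
  · rfl
  · exact Set.indicator_of_mem hz g

/-- While the trajectory stays in `X`, both evaluation conventions give `g` itself, so the chain
rule applies. -/
lemma IsFlow.tendsto_slope (hφ : IsFlow F D φ)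
    {ρ : (EuclideanSpace ℝ (Fin n) → ℝ) → EuclideanSpace ℝ (Fin n) → ℝ}
    (hρ : ρ = id ∨ ρ = X.indicator) {g : EuclideanSpace ℝ (Fin n) → ℝ}
    {z : EuclideanSpace ℝ (Fin n)} (hg : DifferentiableAt ℝ g z) (hz : z ∈ X)
    (hzX : ∀ᶠ t in 𝓝[>] (0 : ℝ), φ t z ∈ X) :
    Tendsto (fun t : ℝ => (1 / t) * (ρ g (φ t z) - ρ g z)) (𝓝[>] 0) (𝓝 (fderiv ℝ g z (F z))) := by
  have h1 := (hφ.hasDerivAt_comp hg).hasDerivWithinAt (s := Set.Ioi 0)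
  rw [hasDerivWithinAt_iff_tendsto_slope' (by simp)] at h1
  refine h1.congr' ?_
  filter_upwards [hzX] with t ht
  rw [eq_apply_of_mem hρ g hz, eq_apply_of_mem hρ g ht]
  simp [slope_def_module, hφ.map_zero]

end Flow

/-! ### Null zero sets and invertible collocation matrices. -/

section NullSets

/-- Induction on the number of variables: viewed as a polynomial in the first variable, `p` has a
leading coefficient that is nonzero at almost every value of the others, leaving finitely many
roots. Fubini concludes. -/
lemma ae_eval_mvPolynomial_ne_zero : ∀ {n : ℕ} {p : MvPolynomial (Fin n) ℝ}, p ≠ 0 →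
    ∀ᵐ v : Fin n → ℝ, MvPolynomial.eval v p ≠ 0
  | 0, p, hp => by
    refine Eventually.of_forall fun v hv => hp ?_
    rw [MvPolynomial.eq_C_of_isEmpty p] at hv ⊢
    rw [MvPolynomial.eval_C] at hv
    rw [hv, map_zero]
  | n + 1, p, hp => by
    have hq : MvPolynomial.finSuccEquiv ℝ n p ≠ 0 := by simpa using hp
    have hlead := ae_eval_mvPolynomial_ne_zero (Polynomial.leadingCoeff_ne_zero.2 hq)
    have hmp := volume_preserving_piFinSuccAbove (fun _ : Fin (n + 1) => ℝ) 0
    have hprod : ∀ᵐ z : ℝ × (Fin n → ℝ), MvPolynomial.eval (Fin.cons z.1 z.2 : Fin (n + 1) → ℝ) p ≠ 0 := by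
      have hm : MeasurableSet {z : ℝ × (Fin n → ℝ) |
          MvPolynomial.eval (Fin.cons z.1 z.2 : Fin (n + 1) → ℝ) p ≠ 0} := by
        have hc : Continuous fun z : ℝ × (Fin n → ℝ) =>
            MvPolynomial.eval (Fin.cons z.1 z.2 : Fin (n + 1) → ℝ) p :=
          (MvPolynomial.continuous_eval p).comp (by fun_prop)
        exact (isOpen_ne_fun hc continuous_const).measurableSet
      refine (Measure.ae_ae_comm
        (p := fun y s => MvPolynomial.eval (Fin.cons y s : Fin (n + 1) → ℝ) p ≠ 0) hm).2 ?_ |>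
          fun h => (Measure.ae_prod_iff_ae_ae hm).2 h
      filter_upwards [hlead] with s hs
      have hne : Polynomial.map (MvPolynomial.eval s) (MvPolynomial.finSuccEquiv ℝ n p) ≠ 0 := by
        intro h0
        apply hs
        have := congrArg (fun q => Polynomial.coeff q (MvPolynomial.finSuccEquiv ℝ n p).natDegree) h0
        simpa [Polynomial.coeff_map] using this
      have hfin : {y : ℝ | ¬ MvPolynomial.eval (Fin.cons y s : Fin (n + 1) → ℝ) p ≠ 0}.Finite := by
        refine (Polynomial.finite_setOfPred_isRoot hne).subset fun y hy => ?_
        rw [Set.mem_ofPred_eq, not_not, MvPolynomial.eval_eq_eval_mv_eval'] at hy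
        exact hy
      exact hfin.measure_zero _
    have := hmp.quasiMeasurePreserving.ae hprod
    filter_upwards [this] with v hv
    convert hv using 3
    ext i
    refine Fin.cases ?_ (fun i => ?_) i <;> simp [MeasurableEquiv.piFinSuccAbove, Fin.tail]

lemma ae_sum_monomialFun_ne_zero {n : ℕ} (S : Finset (Fin n →₀ ℕ)) {c : S → ℝ} (hc : c ≠ 0) :
    ∀ᵐ z : EuclideanSpace ℝ (Fin n), ∑ s : S, c s * monomialFun (s : Fin n →₀ ℕ) z ≠ 0 := by
  set p : MvPolynomial (Fin n) ℝ := ∑ s : S, MvPolynomial.monomial (s : Fin n →₀ ℕ) (c s) with hp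
  have hp0 : p ≠ 0 := by
    intro h
    apply hc
    funext s
    have := congrArg (MvPolynomial.coeff (s : Fin n →₀ ℕ)) h
    classical
    simpa [hp, MvPolynomial.coeff_sum, MvPolynomial.coeff_monomial, Subtype.val_inj] using this
  have h := (PiLp.volume_preserving_ofLp (Fin n)).quasiMeasurePreserving.ae (ae_eval_mvPolynomial_ne_zero hp0)
  filter_upwards [h] with z hz
  convert hz using 1
  simp [hp, MvPolynomial.eval_monomial, monomialFun, Finsupp.prod_fintype]

/-- Independent samples of functions that are linearly independent modulo null sets give an invertible
collocation matrix, almost surely. -/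
lemma ae_pi_det_ne_zero {E : Type*} [MeasurableSpace E] (ν : Measure E) [IsProbabilityMeasure ν] :
    ∀ {m : ℕ} {p : Fin m → E → ℝ}, (∀ i, Measurable (p i)) →
    (∀ c : Fin m → ℝ, c ≠ 0 → ∀ᵐ z ∂ν, ∑ i, c i * p i z ≠ 0) →
    ∀ᵐ v ∂Measure.pi (fun _ : Fin m => ν), (liftMatrix p v).det ≠ 0
  | 0, p, _, _ => by simp
  | m + 1, p, hm, hp => by
    have ih := ae_pi_det_ne_zero ν (p := fun i => p i.succ) (fun i => hm _) (fun c hc => by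
      have := hp (Fin.cons 0 c) (fun h => hc (by
        funext i
        simpa using congrFun h i.succ))
      simpa [Fin.sum_univ_succ] using this)
    have hmp := measurePreserving_piFinSuccAbove (fun _ : Fin (m + 1) => ν) 0
    have hdet : ∀ (k : ℕ) (q : Fin k → E → ℝ), (∀ i, Measurable (q i)) →
        Measurable fun v : Fin k → E => (liftMatrix q v).det := by
      intro k q hq
      simp only [Matrix.det_apply, liftMatrix, Matrix.of_apply]
      fun_prop
    have hmeas : MeasurableSet {z : E × (Fin m → E) |
        (liftMatrix p (Fin.cons z.1 z.2 : Fin (m + 1) → E)).det ≠ 0} := by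
      have : Measurable fun z : E × (Fin m → E) => (liftMatrix p (Fin.cons z.1 z.2 : Fin (m + 1) → E)).det := by
        refine (hdet _ p hm).comp (measurable_pi_lambda _ fun i => ?_)
        refine Fin.cases ?_ (fun i => ?_) i
        · simpa using measurable_fst
        · simpa using! (measurable_pi_apply i).comp measurable_snd
      exact this (measurableSet_singleton 0).compl
    have hprod : ∀ᵐ z ∂ν.prod (Measure.pi fun _ : Fin m => ν),
        (liftMatrix p (Fin.cons z.1 z.2 : Fin (m + 1) → E)).det ≠ 0 := by
      refine (Measure.ae_prod_iff_ae_ae hmeas).2 ((Measure.ae_ae_comm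
        (p := fun y s => (liftMatrix p (Fin.cons y s : Fin (m + 1) → E)).det ≠ 0) hmeas).2 ?_)
      filter_upwards [ih] with s hs
      -- The signed minors of the first row. They do not involve the first sample `y`, and the one
      -- with `j = 0` is nonzero by induction, so the determinant is a nontrivial combination of the
      -- `p j y`.
      set c : Fin (m + 1) → ℝ := fun j =>
        (-1) ^ (j : ℕ) * (liftMatrix (fun i => p (j.succAbove i)) s).det with hc
      have hc0 : c ≠ 0 := by
        intro h
        apply hs
        simpa [hc] using congrFun h 0
      filter_upwards [hp c hc0] with y hy
      rw [Matrix.det_succ_row_zero]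
      convert hy using 1
      refine Finset.sum_congr rfl fun j _ => ?_
      have : (liftMatrix p (Fin.cons y s : Fin (m + 1) → E)).submatrix Fin.succ j.succAbove =
          liftMatrix (fun i => p (j.succAbove i)) s := by
        ext a b; simp [liftMatrix]
      rw [this]
      simp [hc, liftMatrix]
      ring
    have := hmp.quasiMeasurePreserving.ae hprod
    filter_upwards [this] with v hv
    convert hv using 4
    ext i
    refine Fin.cases ?_ (fun i => ?_) i <;> simp [MeasurableEquiv.piFinSuccAbove, Fin.tail]

end NullSets

/-! ### Independent samples: joint law and law of large numbers. -/

section Sampling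

variable {E : Type*} [MeasurableSpace E] {Ω : Type*} [MeasurableSpace Ω] {P : Measure Ω}
  [IsProbabilityMeasure P] {x : ℕ → Ω → E}

lemma ae_det_sample_ne_zero (hxm : ∀ k, Measurable (x k)) (hxi : iIndepFun x P) {ν : Measure E}
    (hx : ∀ k, P.map (x k) = ν) {m : ℕ} {p : Fin m → E → ℝ} (hm : ∀ i, Measurable (p i))
    (hp : ∀ c : Fin m → ℝ, c ≠ 0 → ∀ᵐ z ∂ν, ∑ i, c i * p i z ≠ 0) :
    ∀ᵐ ω ∂P, (liftMatrix p fun k : Fin m => x k ω).det ≠ 0 := by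
  have : IsProbabilityMeasure ν := hx 0 ▸ Measure.isProbabilityMeasure_map (hxm 0).aemeasurable
  have hxi' : iIndepFun (fun k : Fin m => x k) P := hxi.precomp Fin.val_injective
  have h1 := iIndepFun.map_fun_eq_pi_map (f := fun k : Fin m => x k)
    (fun k => (hxm k).aemeasurable) hxi'
  simp only [hx] at h1
  have h2 := ae_pi_det_ne_zero ν hm hp
  rw [← h1] at h2
  exact ae_of_ae_map (measurable_pi_lambda _ fun k : Fin m => hxm k).aemeasurable h2

omit [IsProbabilityMeasure P] in
lemma strong_law_comp (hxm : ∀ k, Measurable (x k)) (hxi : iIndepFun x P) {ν : Measure E}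
    (hx : ∀ k, P.map (x k) = ν) {f : E → ℝ} (hf : Measurable f) (hint : Integrable f ν) :
    ∀ᵐ ω ∂P, Tendsto (fun K : ℕ => (∑ k : Fin K, f (x k ω)) / K) atTop (𝓝 (∫ z, f z ∂ν)) := by
  have h := strong_law_ae_real (μ := P) (fun k ω => f (x k ω))
    (by
      have : Integrable f (P.map (x 0)) := by rwa [hx]
      exact this.comp_measurable (hxm 0))
    (fun i j hij => (hxi.indepFun hij).comp hf hf)
    (fun i => ⟨(hf.comp (hxm i)).aemeasurable, (hf.comp (hxm 0)).aemeasurable, by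
      change P.map (f ∘ x i) = P.map (f ∘ x 0)
      rw [← Measure.map_map hf (hxm i), ← Measure.map_map hf (hxm 0), hx, hx]⟩)
  filter_upwards [h] with ω hω
  have h0 : ∫ z, f z ∂ν = P[fun ω => f (x 0 ω)] := by
    rw [← hx 0, integral_map (hxm 0).aemeasurable hf.aestronglyMeasurable]
  rw [h0]
  refine hω.congr fun K => ?_
  rw [Finset.sum_range]

end Sampling

/-! ### Galerkin approximation in a Hilbert space. -/

section Projection

variable {H : Type*} [NormedAddCommGroup H] [InnerProductSpace ℝ H]

/-- Coefficients of the best approximation of `f` by the first `N` vectors of a sequence. -/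
noncomputable def galerkinCoeff (G : ℕ → H) (f : H) (N : ℕ) : Fin N → ℝ :=
  (Matrix.gram ℝ fun i : Fin N => G i)⁻¹.mulVec fun i => inner ℝ (G i) f

lemma isUnit_gram {G : ℕ → H} (hG : LinearIndependent ℝ G) (N : ℕ) :
    IsUnit (Matrix.gram ℝ fun i : Fin N => G i) := by
  rw [Matrix.isUnit_iff_isUnit_det, isUnit_iff_ne_zero, Matrix.det_gram_ne_zero_iff_linearIndependent]
  exact hG.comp _ Fin.val_injective

/-- This is the `i`-th row of the Gram system. -/
lemma inner_galerkin_sub {G : ℕ → H} (hG : LinearIndependent ℝ G) (f : H) (N : ℕ) (i : Fin N) :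
    inner ℝ (G i) (∑ k, galerkinCoeff G f N k • G k - f) = 0 := by
  have h : (Matrix.gram ℝ fun i : Fin N => G i).mulVec (galerkinCoeff G f N) = fun i : Fin N => inner ℝ (G i) f := by
    rw [galerkinCoeff, Matrix.mulVec_mulVec,
      Matrix.mul_nonsing_inv _ ((Matrix.isUnit_iff_isUnit_det _).1 (isUnit_gram hG N)), Matrix.one_mulVec]
  have hi := congrFun h i
  simp only [Matrix.mulVec, dotProduct, Matrix.gram_apply] at hi
  rw [inner_sub_right, inner_sum, ← hi, sub_eq_zero]
  refine Finset.sum_congr rfl fun k _ => ?_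
  rw [real_inner_smul_right, mul_comm]

/-- Some `v` in the span of finitely many `G k` is within `ε` of `f`. Once `N` covers these indices,
the residual is orthogonal to `v - q`, and Pythagoras bounds its norm by that of `v - f`. -/
lemma tendsto_galerkin {G : ℕ → H} (hG : LinearIndependent ℝ G)
    (hd : Dense (Submodule.span ℝ (Set.range G) : Set H)) (f : H) :
    Tendsto (fun N => ∑ k : Fin N, galerkinCoeff G f N k • G k) atTop (𝓝 f) := by
  rw [Metric.tendsto_atTop]
  intro ε hε
  obtain ⟨v, hv, hvε⟩ := Metric.dense_iff.1 hd f ε hε |>.imp fun v h => And.intro h.2 h.1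
  have hspan : ∃ N0, v ∈ Submodule.span ℝ (G '' Set.Iio N0) := by
    refine Submodule.span_induction (p := fun v _ => ∃ N0, v ∈ Submodule.span ℝ (G '' Set.Iio N0)) ?_ ?_ ?_ ?_ hv
    · rintro _ ⟨k, rfl⟩
      exact ⟨k + 1, Submodule.subset_span ⟨k, by simp, rfl⟩⟩
    · exact ⟨0, zero_mem _⟩
    · rintro a b _ _ ⟨N1, h1⟩ ⟨N2, h2⟩
      refine ⟨max N1 N2, add_mem (Submodule.span_mono (Set.image_mono ?_) h1)
        (Submodule.span_mono (Set.image_mono ?_) h2)⟩ <;> intro k hk <;> simp_all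
    · rintro r a _ ⟨N1, h1⟩
      exact ⟨N1, Submodule.smul_mem _ _ h1⟩
  obtain ⟨N0, hN0⟩ := hspan
  refine ⟨N0, fun N hN => ?_⟩
  set q := ∑ k : Fin N, galerkinCoeff G f N k • G k with hq
  have horth : ∀ u ∈ Submodule.span ℝ (G '' Set.Iio N), inner ℝ u (q - f) = 0 := by
    intro u hu
    refine Submodule.span_induction (p := fun u _ => inner ℝ u (q - f) = 0) ?_ (inner_zero_left _) ?_ ?_ hu
    · rintro _ ⟨k, hk, rfl⟩
      exact inner_galerkin_sub hG f N ⟨k, hk⟩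
    · intro a b _ _ ha hb
      rw [inner_add_left, ha, hb, add_zero]
    · intro r a _ ha
      rw [real_inner_smul_left, ha, mul_zero]
  have hvq : v - q ∈ Submodule.span ℝ (G '' Set.Iio N) :=
    sub_mem (Submodule.span_mono (Set.image_mono (Set.Iio_subset_Iio hN)) hN0)
      (sum_mem fun k _ => Submodule.smul_mem _ _ (Submodule.subset_span ⟨k, k.2, rfl⟩))
  have hpyth := norm_add_sq_eq_norm_sq_add_norm_sq_real (horth _ hvq)
  rw [sub_add_sub_cancel] at hpyth
  have hvε' : ‖v - f‖ < ε := by rwa [← dist_eq_norm]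
  rw [dist_eq_norm]
  nlinarith [norm_nonneg (v - f), norm_nonneg (q - f), mul_self_nonneg ‖v - q‖]

end Projection

/-! ### Passing between functions and their classes in L². -/

section L2

variable {E : Type*} [MeasurableSpace E] {μ : Measure E}

lemma inner_Lp_eq {G₁ G₂ : Lp ℝ 2 μ} {g₁ g₂ : E → ℝ} (h₁ : G₁ =ᵐ[μ] g₁) (h₂ : G₂ =ᵐ[μ] g₂) :
    inner ℝ G₁ G₂ = ∫ z, g₁ z * g₂ z ∂μ := by
  rw [L2.inner_def]
  refine integral_congr_ae ?_
  filter_upwards [h₁, h₂] with z hz₁ hz₂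
  rw [hz₁, hz₂]
  simp [mul_comm]

/-- As a norm in L², the error is visibly continuous in the coefficients `c`, so limits of
coefficients pass to it. -/
lemma eLpNorm_sum_sub_eq {ι : Type*} [Fintype ι] {G : ι → Lp ℝ 2 μ} {g : ι → E → ℝ} {f : E → ℝ} {f' : Lp ℝ 2 μ}
    (hG : ∀ i, G i =ᵐ[μ] g i) (hf : f' =ᵐ[μ] f) (c : ι → ℝ) :
    eLpNorm (fun z => ∑ i, c i * g i z - f z) 2 μ = ‖∑ i, c i • G i - f'‖ₑ := by
  rw [Lp.enorm_def]
  refine eLpNorm_congr_ae ?_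
  have hsum : ((∑ i, c i • G i : Lp ℝ 2 μ) : E → ℝ) =ᵐ[μ] fun z => ∑ i, c i * g i z := by
    suffices h : ∀ s : Finset ι, ((∑ i ∈ s, c i • G i : Lp ℝ 2 μ) : E → ℝ) =ᵐ[μ] fun z => ∑ i ∈ s, c i * g i z from
      h Finset.univ
    intro s
    classical
    induction s using Finset.induction_on with
    | empty =>
      simp only [Finset.sum_empty]
      exact Lp.coeFn_zero ℝ 2 μ
    | insert a s ha ih =>
      rw [Finset.sum_insert ha]
      filter_upwards [Lp.coeFn_add (c a • G a) (∑ i ∈ s, c i • G i), Lp.coeFn_smul (c a) (G a), hG a, ih]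
        with z h1 h2 h3 h4
      rw [h1, Pi.add_apply, h2, h4, Pi.smul_apply, h3, Finset.sum_insert ha, smul_eq_mul]
  filter_upwards [Lp.coeFn_sub (∑ i, c i • G i) f', hsum, hf] with z h1 h2 h3
  rw [h1, Pi.sub_apply, h2, h3]

end L2

/-! ### Uniform samples in a compact set. -/

section UniformSampling

variable {n : ℕ} {X : Set (EuclideanSpace ℝ (Fin n))} {Ω : Type*} [MeasurableSpace Ω] {P : Measure Ω}
  {x : ℕ → Ω → EuclideanSpace ℝ (Fin n)}

lemma ae_forall_sample (hxm : ∀ k, Measurable (x k)) (hxu : ∀ k, pdf.IsUniform (x k) X P volume)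
    {q : EuclideanSpace ℝ (Fin n) → Prop} (hq : ∀ᵐ z ∂volume.restrict X, q z) :
    ∀ᵐ ω ∂P, ∀ k, q (x k ω) := by
  refine ae_all_iff.2 fun k => ae_of_ae_map (hxm k).aemeasurable ?_
  rw [hxu k, ProbabilityTheory.cond]
  exact Measure.ae_smul_measure hq _

/-- Only the behavior of `f` on `X` is controlled, so the law is applied to its extension by zero,
which agrees with `f` at all samples almost surely. -/
lemma strong_law_uniform (hXc : IsCompact X) (hXpos : volume X ≠ 0)
    (hxm : ∀ k, Measurable (x k)) (hxu : ∀ k, pdf.IsUniform (x k) X P volume) (hxi : iIndepFun x P)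
    {f : EuclideanSpace ℝ (Fin n) → ℝ} (hf : ContinuousOn f X) :
    ∀ᵐ ω ∂P, Tendsto (fun K : ℕ => (∑ k : Fin K, f (x k ω)) / K) atTop
      (𝓝 ((volume X).toReal⁻¹ * ∫ z in X, f z)) := by
  classical
  have hXm := hXc.measurableSet
  have hm : Measurable (X.indicator f) := by
    have := hf.measurable_piecewise (continuousOn_const (c := (0 : ℝ)) (s := Xᶜ)) hXm
    rwa [← Pi.zero_def, Set.piecewise_eq_indicator] at this
  have hint : Integrable (X.indicator f) (cond volume X) := by
    have h1 : Integrable (X.indicator f) (volume.restrict X) :=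
      ((integrable_indicator_iff hXm).2 (hf.integrableOn_compact hXc)).integrableOn
    exact h1.smul_measure (ENNReal.inv_ne_top.2 hXpos)
  have hval : ∫ z, X.indicator f z ∂(cond volume X) = (volume X).toReal⁻¹ * ∫ z in X, f z := by
    rw [ProbabilityTheory.cond, integral_smul_measure, setIntegral_indicator hXm, Set.inter_self,
      ENNReal.toReal_inv, smul_eq_mul]
  have h := strong_law_comp hxm hxi (fun k => hxu k) hm hint
  rw [hval] at h
  filter_upwards [h, ae_forall_sample hxm hxu (ae_restrict_mem hXm)] with ω hω hmem
  simpa only [Set.indicator_of_mem (hmem _)] using hω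

end UniformSampling

/-! ### Limits of the least-squares problem in `T` and in `K`. -/

section LeastSquares

variable {n : ℕ} {F : EuclideanSpace ℝ (Fin n) → EuclideanSpace ℝ (Fin n)}
    {D : Set (ℝ × EuclideanSpace ℝ (Fin n))}
    {φ : ℝ → EuclideanSpace ℝ (Fin n) → EuclideanSpace ℝ (Fin n)}
    {X : Set (EuclideanSpace ℝ (Fin n))}
    {ρ : (EuclideanSpace ℝ (Fin n) → ℝ) → EuclideanSpace ℝ (Fin n) → ℝ}

/-- For a full-rank sample the estimated generator has a limit as the sampling period vanishes; the column of
a coordinate function is the least-squares fit to the component of the vector field. -/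
lemma tendsto_generatorEstimate_apply (hφ : IsFlow F D φ)
    (hX : ForwardInvariant D φ X ∨ BackwardInvariant D φ X) (hρ : ρ = id ∨ ρ = X.indicator)
    {ι : Type*} [Fintype ι] [DecidableEq ι] {p : ι → EuclideanSpace ℝ (Fin n) → ℝ}
    (hp : ∀ i, ∀ z ∈ X, DifferentiableAt ℝ (p i) z) {K : ℕ} {u : Fin K → EuclideanSpace ℝ (Fin n)}
    (hu : ∀ k, u k ∈ X) (huX : ∀ k, ∀ᶠ t in 𝓝[>] (0 : ℝ), φ t (u k) ∈ X)
    (hunit : IsUnit ((liftMatrix p u).transpose * liftMatrix p u)) {j : Fin n} {l : ι}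
    (hl : ∀ z ∈ X, p l z = z j) (i : ι) :
    Tendsto (fun T : ℝ => generatorEstimate (fun i => ρ (p i)) T u (fun k => φ T (u k)) i l) (𝓝[>] 0)
      (𝓝 ((pinv (liftMatrix p u)).mulVec (fun k => F (u k) j) i)) := by
  have hlift : liftMatrix (fun i => ρ (p i)) u = liftMatrix p u := by
    ext k i
    exact eq_apply_of_mem hρ (p i) (hu k)
  have h := tendsto_generatorEstimate (p := fun i => ρ (p i)) (x := u) (y := fun T k => φ T (u k))
    (Q := Matrix.of fun k i => fderiv ℝ (p i) (u k) (F (u k)))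
    (by rwa [hlift]) (by funext k; exact hφ.map_zero _)
    (fun k i => hφ.tendsto_slope hρ (hp i _ (hu k)) (hu k) (huX k))
  have h2 := tendsto_pi_nhds.1 (tendsto_pi_nhds.1 h i) l
  rw [hlift] at h2
  convert h2 using 2
  simp only [Matrix.mul_apply, Matrix.mulVec, dotProduct, Matrix.of_apply]
  refine Finset.sum_congr rfl fun k _ => ?_
  rw [hφ.fderiv_apply_of_eqOn_coord hX hl (hu k) (hp l _ (hu k))]

/-- If the empirical moments converge, then so do the least-squares coefficients. -/
lemma tendsto_pinv_mulVec {E ι : Type*} [Fintype ι] [DecidableEq ι] {p : ι → E → ℝ} {f : E → ℝ} {u : ℕ → E}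
    {Γ : Matrix ι ι ℝ} {γ : ι → ℝ} {c : ℝ} (hc : c ≠ 0) (hΓ : IsUnit Γ)
    (hp : ∀ i i', Tendsto (fun K : ℕ => (∑ k : Fin K, p i (u k) * p i' (u k)) / K) atTop (𝓝 (c * Γ i i')))
    (hf : ∀ i, Tendsto (fun K : ℕ => (∑ k : Fin K, p i (u k) * f (u k)) / K) atTop (𝓝 (c * γ i))) :
    (∀ᶠ K : ℕ in atTop, IsUnit ((liftMatrix p fun k : Fin K => u k).transpose *
        liftMatrix p fun k : Fin K => u k)) ∧
      Tendsto (fun K : ℕ => (pinv (liftMatrix p fun k : Fin K => u k)).mulVec fun k => f (u k)) atTop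
        (𝓝 (Γ⁻¹.mulVec γ)) := by
  set A : (K : ℕ) → Matrix (Fin K) ι ℝ := fun K => liftMatrix p fun k : Fin K => u k with hA
  set M : ℕ → Matrix ι ι ℝ := fun K => (K : ℝ)⁻¹ • ((A K).transpose * A K) with hM
  set m : ℕ → ι → ℝ := fun K => (K : ℝ)⁻¹ • (A K).transpose.mulVec (fun k => f (u k)) with hm
  have hMlim : Tendsto M atTop (𝓝 (c • Γ)) := by
    refine tendsto_pi_nhds.2 fun i => tendsto_pi_nhds.2 fun i' => ?_
    refine (hp i i').congr fun K => ?_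
    simp [hM, hA, Matrix.mul_apply, liftMatrix, div_eq_inv_mul]
  have hmlim : Tendsto m atTop (𝓝 (c • γ)) := by
    refine tendsto_pi_nhds.2 fun i => ?_
    refine (hf i).congr fun K => ?_
    simp [hm, hA, Matrix.mulVec, dotProduct, liftMatrix, div_eq_inv_mul]
  have hcΓ : IsUnit (c • Γ) := by
    have := hΓ.smul (Units.mk0 c hc)
    exact this
  have hMunit : ∀ᶠ K in atTop, IsUnit (M K) := by
    have hdet : Tendsto (fun K => (M K).det) atTop (𝓝 (c • Γ).det) :=
      ((continuous_id.matrix_det).tendsto _).comp hMlim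
    have hne := isUnit_iff_ne_zero.1 ((Matrix.isUnit_iff_isUnit_det _).1 hcΓ)
    filter_upwards [hdet.eventually (isOpen_ne.mem_nhds hne)] with K hK
    exact (Matrix.isUnit_iff_isUnit_det _).2 (isUnit_iff_ne_zero.2 hK)
  have hunit : ∀ᶠ K in atTop, IsUnit ((A K).transpose * A K) := by
    filter_upwards [hMunit, eventually_gt_atTop 0] with K hK hK0
    have hK' : (K : ℝ) ≠ 0 := by positivity
    have h1 : (A K).transpose * A K = (K : ℝ) • M K := by
      rw [hM]; simp [smul_smul, hK']
    rw [h1]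
    exact hK.smul (Units.mk0 (K : ℝ) hK')
  refine ⟨hunit, ?_⟩
  have hlim : Tendsto (fun K => (M K)⁻¹.mulVec (m K)) atTop (𝓝 ((c • Γ)⁻¹.mulVec (c • γ))) := by
    have hcont : Continuous fun z : Matrix ι ι ℝ × (ι → ℝ) => z.1.mulVec z.2 :=
      continuous_fst.matrix_mulVec continuous_snd
    exact (hcont.tendsto _).comp ((tendsto_matrix_inv hMlim hcΓ).prodMk_nhds hmlim)
  -- The normalization `c`, which is `1 / μ(X)` for uniform samples, cancels between the two
  -- moments.
  have hval : (c • Γ)⁻¹.mulVec (c • γ) = Γ⁻¹.mulVec γ := by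
    have h1 : c • γ = (c • Γ).mulVec (Γ⁻¹.mulVec γ) := by
      rw [Matrix.smul_mulVec, Matrix.mulVec_mulVec,
        Matrix.mul_nonsing_inv _ ((Matrix.isUnit_iff_isUnit_det _).1 hΓ), Matrix.one_mulVec]
    rw [h1, Matrix.mulVec_mulVec, Matrix.nonsing_inv_mul _ ((Matrix.isUnit_iff_isUnit_det _).1 hcΓ),
      Matrix.one_mulVec]
  rw [hval] at hlim
  refine hlim.congr' ?_
  filter_upwards [hMunit, hunit] with K hK1 hK2
  have h2 : m K = (M K).mulVec ((pinv (A K)).mulVec fun k => f (u k)) := by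
    rw [pinv_eq hK2, hM, Matrix.smul_mulVec, Matrix.mulVec_mulVec, ← Matrix.mul_assoc,
      Matrix.mul_nonsing_inv _ ((Matrix.isUnit_iff_isUnit_det _).1 hK2), Matrix.one_mul]
  rw [h2, Matrix.mulVec_mulVec, Matrix.nonsing_inv_mul _ ((Matrix.isUnit_iff_isUnit_det _).1 hK1),
    Matrix.one_mulVec]

end LeastSquares

/-! ### The two convergence statements. -/

section Main

variable {n : ℕ} {F : EuclideanSpace ℝ (Fin n) → EuclideanSpace ℝ (Fin n)}
    {D : Set (ℝ × EuclideanSpace ℝ (Fin n))}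
    {φ : ℝ → EuclideanSpace ℝ (Fin n) → EuclideanSpace ℝ (Fin n)}
    {X : Set (EuclideanSpace ℝ (Fin n))}
    {ρ : (EuclideanSpace ℝ (Fin n) → ℝ) → EuclideanSpace ℝ (Fin n) → ℝ}
    {Ω : Type*} [MeasurableSpace Ω] {P : Measure Ω} {x : ℕ → Ω → EuclideanSpace ℝ (Fin n)}

theorem ae_tendsto_fieldEstimate (hF : Continuous F) (hφ : IsFlow F D φ) (hns : IsNonsingularFlow D φ)
    (hXc : IsCompact X) (hXpos : volume X ≠ 0) (hXinv : ForwardInvariant D φ X ∨ BackwardInvariant D φ X)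
    (hρ : ρ = id ∨ ρ = X.indicator) (hxm : ∀ k, Measurable (x k))
    (hxu : ∀ k, pdf.IsUniform (x k) X P volume) (hxi : iIndepFun x P)
    {g : ℕ → EuclideanSpace ℝ (Fin n) → ℝ} {G : ℕ → Lp ℝ 2 (volume.restrict X)} {l : Fin n → ℕ}
    (hg : ∀ k, ∀ z ∈ X, DifferentiableAt ℝ (g k) z) (hG : ∀ k, G k =ᵐ[volume.restrict X] g k)
    (hlin : LinearIndependent ℝ G)
    (hd : Dense (Submodule.span ℝ (Set.range G) : Set (Lp ℝ 2 (volume.restrict X))))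
    (hl : ∀ j, ∀ z ∈ X, g (l j) z = z j) :
    ∀ᵐ ω ∂P, ∀ j : Fin n, ∃ (a : ℕ → ℕ → ℝ≥0∞) (b : ℕ → ℝ≥0∞),
      (∀ N, ∀ hN : l j < N,
        (∀ᶠ K in atTop, Tendsto
          (fun T : ℝ => eLpNorm
            (fun z => fieldEstimate (fun i : Fin N => ρ (g i)) T
              (fun k : Fin K => x k ω) (fun k : Fin K => φ T (x k ω)) ⟨l j, hN⟩ z - F z j)
            2 (volume.restrict X))
          (𝓝[>] 0) (𝓝 (a N K))) ∧
        Tendsto (a N) atTop (𝓝 (b N))) ∧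
      Tendsto b atTop (𝓝 0) := by
  have hXm := hXc.measurableSet
  have hgc : ∀ k, ContinuousOn (g k) X := fun k z hz => (hg k z hz).continuousAt.continuousWithinAt
  have hFc : ∀ j, ContinuousOn (fun z => F z j) X := fun j =>
    (((EuclideanSpace.proj j : EuclideanSpace ℝ (Fin n) →L[ℝ] ℝ).continuous).comp hF).continuousOn
  have : IsFiniteMeasure (volume.restrict X) :=
    isFiniteMeasure_restrict.2 hXc.measure_lt_top.ne
  have hFL : ∀ j, MemLp (fun z => F z j) 2 (volume.restrict X) := fun j => by
    obtain ⟨C, hC⟩ := hXc.exists_bound_of_continuousOn (hFc j)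
    exact MemLp.of_bound ((hFc j).aestronglyMeasurable hXm) C ((ae_restrict_iff' hXm).2 (Eventually.of_forall hC))
  have hc : (volume X).toReal⁻¹ ≠ 0 :=
    inv_ne_zero (ENNReal.toReal_ne_zero.2 ⟨hXpos, hXc.measure_lt_top.ne⟩)
  -- Only countably many moments occur, so a single exceptional null set serves all `N` and `j`.
  have hsl1 := ae_all_iff.2 fun i => ae_all_iff.2 fun i' =>
    strong_law_uniform hXc hXpos hxm hxu hxi ((hgc i).mul (hgc i'))
  have hsl2 := ae_all_iff.2 fun i => ae_all_iff.2 fun j =>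
    strong_law_uniform hXc hXpos hxm hxu hxi ((hgc i).mul (hFc j))
  filter_upwards [hsl1, hsl2, ae_forall_sample hxm hxu (ae_restrict_mem hXm),
    ae_forall_sample hxm hxu (ae_eventually_mem_of_invariant hφ hns hXm hXinv)] with ω h1 h2 h3 h4 j
  set f : Lp ℝ 2 (volume.restrict X) := (hFL j).toLp _ with hf
  have hfae : f =ᵐ[volume.restrict X] fun z => F z j := (hFL j).coeFn_toLp
  have hcont : ∀ N, Continuous fun c : Fin N → ℝ => ‖∑ i, c i • G i - f‖ₑ := fun N => by fun_prop
  -- The inner limit is the error of the fit to `K` samples; the middle one is the distance from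
  -- `F_j` to the span of the first `N` functions.
  refine ⟨fun N K => ‖∑ i : Fin N, (pinv (liftMatrix (fun i : Fin N => g i) fun k : Fin K => x k ω)).mulVec
      (fun k => F (x k ω) j) i • G i - f‖ₑ,
    fun N => ‖∑ i : Fin N, galerkinCoeff G f N i • G i - f‖ₑ, fun N hN => ?_, ?_⟩
  · obtain ⟨hunit, hlim⟩ := tendsto_pinv_mulVec (p := fun i : Fin N => g i) (f := fun z => F z j)
      (u := fun k => x k ω) (γ := fun i : Fin N => inner ℝ (G i) f) hc (isUnit_gram hlin N)
      (fun i i' => by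
        rw [Matrix.gram_apply, inner_Lp_eq (hG i) (hG i')]
        exact h1 i i')
      (fun i => by
        rw [inner_Lp_eq (hG i) hfae]
        exact h2 i j)
    refine ⟨?_, ((hcont N).tendsto _).comp hlim⟩
    filter_upwards [hunit] with K hK
    have hT : Tendsto (fun T : ℝ => fun i : Fin N => generatorEstimate (fun i : Fin N => ρ (g i)) T
        (fun k : Fin K => x k ω) (fun k : Fin K => φ T (x k ω)) i ⟨l j, hN⟩) (𝓝[>] 0)
        (𝓝 ((pinv (liftMatrix (fun i : Fin N => g i) fun k : Fin K => x k ω)).mulVec fun k => F (x k ω) j)) :=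
      tendsto_pi_nhds.2 fun i => tendsto_generatorEstimate_apply (p := fun i : Fin N => g i) hφ hXinv hρ
        (fun i z hz => hg i z hz) (fun k => h3 k) (fun k => h4 k) hK (l := ⟨l j, hN⟩) (hl j) i
    refine (((hcont N).tendsto _).comp hT).congr fun T => ?_
    refine (eLpNorm_sum_sub_eq (fun i : Fin N => (?_ : G i =ᵐ[volume.restrict X] ρ (g i))) hfae _).symm
    filter_upwards [hG i, ae_restrict_mem hXm] with z hz hzX
    rw [hz, eq_apply_of_mem hρ _ hzX]
  · have := (tendsto_galerkin hlin hd f).sub_const f |>.enorm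
    simpa using this

lemma differentiable_monomialFun (s : Fin n →₀ ℕ) : Differentiable ℝ (monomialFun s) := by
  unfold monomialFun
  fun_prop

lemma monomialFun_single (j : Fin n) (z : EuclideanSpace ℝ (Fin n)) :
    monomialFun (Finsupp.single j 1) z = z j := by
  rw [monomialFun, Finset.prod_eq_single j]
  · simp
  · intro i _ hij
    simp [Finsupp.single_eq_of_ne hij]
  · simp

/-- Almost surely, every large enough collection of samples distinguishes all combinations of any given
monomials. -/
lemma ae_injective_liftMatrix_monomialFun [IsProbabilityMeasure P] (hxm : ∀ k, Measurable (x k))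
    (hxu : ∀ k, pdf.IsUniform (x k) X P volume) (hxi : iIndepFun x P) :
    ∀ᵐ ω ∂P, ∀ (S : Finset (Fin n →₀ ℕ)) (K : ℕ), S.card ≤ K →
      Function.Injective (liftMatrix (fun i : S => monomialFun (i : Fin n →₀ ℕ))
        fun k : Fin K => x k ω).mulVec := by
  -- There are countably many finite sets of exponents, and for each the first `S.card` rows already
  -- suffice; further samples cannot lower the rank.
  have h : ∀ᵐ ω ∂P, ∀ S : Finset (Fin n →₀ ℕ),
      (liftMatrix (fun i : Fin S.card => monomialFun (S.equivFin.symm i : Fin n →₀ ℕ))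
        fun k : Fin S.card => x k ω).det ≠ 0 := by
    refine ae_all_iff.2 fun S => ae_det_sample_ne_zero hxm hxi (fun k => hxu k)
      (fun i => (differentiable_monomialFun _).continuous.measurable) fun c hc => ?_
    have hc' : c ∘ S.equivFin ≠ 0 := by
      intro h0
      apply hc
      funext i
      simpa using congrFun h0 (S.equivFin.symm i)
    have h1 := Measure.ae_smul_measure (ae_restrict_of_ae (s := X) (ae_sum_monomialFun_ne_zero S hc'))
      (volume X)⁻¹
    filter_upwards [h1] with z hz
    rw [← S.equivFin.symm.sum_comp] at hz
    simpa using hz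
  filter_upwards [h] with ω hω S K hK
  refine (injective_iff_map_eq_zero (Matrix.mulVecLin _)).2 fun c hc => ?_
  rw [Matrix.mulVecLin_apply] at hc
  have h0 : (liftMatrix (fun i : Fin S.card => monomialFun (S.equivFin.symm i : Fin n →₀ ℕ))
      fun k : Fin S.card => x k ω).mulVec (c ∘ S.equivFin.symm) = 0 := by
    funext k
    have := congrFun hc (Fin.castLE hK k)
    simp only [Matrix.mulVec, dotProduct, liftMatrix, Matrix.of_apply, Pi.zero_apply, Fin.val_castLE] at this
    rw [← S.equivFin.symm.sum_comp] at this
    simpa [Matrix.mulVec, dotProduct, liftMatrix] using this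
  have h1 := Matrix.eq_zero_of_mulVec_eq_zero (hω S) h0
  funext i
  simpa using congrFun h1 (S.equivFin i)

theorem ae_tendsto_generatorEstimate_monomialFun [IsProbabilityMeasure P]
    (hφ : IsFlow F D φ) (hns : IsNonsingularFlow D φ)
    (hXc : IsCompact X) (hXinv : ForwardInvariant D φ X ∨ BackwardInvariant D φ X)
    (hρ : ρ = id ∨ ρ = X.indicator) (hxm : ∀ k, Measurable (x k))
    (hxu : ∀ k, pdf.IsUniform (x k) X P volume) (hxi : iIndepFun x P)
    {R : Finset (Fin n →₀ ℕ)} {w : (Fin n →₀ ℕ) → EuclideanSpace ℝ (Fin n)}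
    (hw : ∀ z, F z = ∑ s ∈ R, monomialFun s z • w s) :
    ∀ᵐ ω ∂P, ∀ (S : Finset (Fin n →₀ ℕ)) (hS : R ⊆ S) (hlin : ∀ j, Finsupp.single j 1 ∈ S) (K : ℕ),
      S.card ≤ K → ∀ (j : Fin n) (s : Fin n →₀ ℕ) (hs : s ∈ R),
        Tendsto
          (fun T : ℝ => generatorEstimate (fun i : S => ρ (monomialFun (i : Fin n →₀ ℕ))) T
            (fun k : Fin K => x k ω) (fun k : Fin K => φ T (x k ω))
            ⟨s, hS hs⟩ ⟨Finsupp.single j 1, hlin j⟩)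
          (𝓝[>] 0) (𝓝 (w s j)) := by
  classical
  have hXm := hXc.measurableSet
  filter_upwards [ae_injective_liftMatrix_monomialFun hxm hxu hxi,
    ae_forall_sample hxm hxu (ae_restrict_mem hXm),
    ae_forall_sample hxm hxu (ae_eventually_mem_of_invariant hφ hns hXm hXinv)]
    with ω hinj h3 h4 S hS hlin K hK j s hs
  have hunit := isUnit_transpose_mul_self (hinj S K hK)
  have h := tendsto_generatorEstimate_apply (p := fun i : S => monomialFun (i : Fin n →₀ ℕ)) hφ hXinv hρ
    (fun i z _ => differentiable_monomialFun _ z) (fun k : Fin K => h3 k) (fun k => h4 k) hunit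
    (l := ⟨Finsupp.single j 1, hlin j⟩) (fun z _ => monomialFun_single j z) ⟨s, hS hs⟩
  -- The sampled `F_j` is exactly `P_x` times the coefficients, extended by zero from `R` to `S`,
  -- and `P_x† P_x = 1` recovers them.
  have hcol : (fun k : Fin K => F (x k ω) j) =
      (liftMatrix (fun i : S => monomialFun (i : Fin n →₀ ℕ)) fun k : Fin K => x k ω).mulVec
        fun i => if (i : Fin n →₀ ℕ) ∈ R then w i j else 0 := by
    funext k
    simp only [Matrix.mulVec, dotProduct, liftMatrix, Matrix.of_apply, hw]
    rw [Finset.sum_coe_sort S fun i => monomialFun i (x k ω) * if i ∈ R then w i j else 0]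
    simp only [mul_ite, mul_zero]
    rw [Finset.sum_ite_mem, Finset.inter_eq_right.2 hS]
    simp
  rw [hcol, Matrix.mulVec_mulVec, pinv_mul_self hunit, Matrix.one_mulVec] at h
  simpa [hs] using h

end Main

end Lifting

theorem theorem1 {n : ℕ}
    (F : EuclideanSpace ℝ (Fin n) → EuclideanSpace ℝ (Fin n)) (hF : Continuous F)
    (D : Set (ℝ × EuclideanSpace ℝ (Fin n)))
    (φ : ℝ → EuclideanSpace ℝ (Fin n) → EuclideanSpace ℝ (Fin n))
    (hφ : Lifting.IsFlow F D φ) (hns : Lifting.IsNonsingularFlow D φ)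
    (X : Set (EuclideanSpace ℝ (Fin n))) (hXc : IsCompact X) (hXpos : volume X ≠ 0)
    (hXinv : Lifting.ForwardInvariant D φ X ∨ Lifting.BackwardInvariant D φ X)
    -- basis functions are evaluated as they are, or after extension from `X` by zero
    (ρ : (EuclideanSpace ℝ (Fin n) → ℝ) → EuclideanSpace ℝ (Fin n) → ℝ)
    (hρ : ρ = id ∨ ρ = X.indicator)
    -- independent sample points, uniformly distributed in `X`
    {Ω : Type*} [MeasurableSpace Ω] (P : Measure Ω) [IsProbabilityMeasure P]
    (x : ℕ → Ω → EuclideanSpace ℝ (Fin n)) (hxm : ∀ k, Measurable (x k))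
    (hxu : ∀ k, pdf.IsUniform (x k) X P volume) (hxi : iIndepFun x P) :
    -- general basis `g 0, g 1, …`, whose classes `G 0, G 1, …` in `L²(X)` are linearly independent with dense span
    (∀ (g : ℕ → EuclideanSpace ℝ (Fin n) → ℝ)
      (G : ℕ → Lp ℝ 2 (volume.restrict X)) (l : Fin n → ℕ),
      (∀ k, ∀ z ∈ X, ContDiffAt ℝ 1 (g k) z) →
      (∀ k, G k =ᵐ[volume.restrict X] g k) →
      LinearIndependent ℝ G →
      Dense (Submodule.span ℝ (Set.range G) : Set (Lp ℝ 2 (volume.restrict X))) →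
      (∀ j, ∀ z ∈ X, g (l j) z = z j) →
      ∀ᵐ ω ∂P, ∀ j : Fin n, ∃ (a : ℕ → ℕ → ℝ≥0∞) (b : ℕ → ℝ≥0∞),
        (∀ N, ∀ hN : l j < N,
          (∀ᶠ K in atTop, Tendsto
            (fun T : ℝ => eLpNorm
              (fun z => Lifting.fieldEstimate (fun i : Fin N => ρ (g i)) T
                (fun k : Fin K => x k ω) (fun k : Fin K => φ T (x k ω)) ⟨l j, hN⟩ z - F z j)
              2 (volume.restrict X))
            (𝓝[>] 0) (𝓝 (a N K))) ∧
          Tendsto (a N) atTop (𝓝 (b N))) ∧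
        Tendsto b atTop (𝓝 0)) ∧
    -- polynomial vector field of degree at most `mF`, basis of monomials with exponents in `S`
    (∀ (mF : ℕ) (w : (Fin n →₀ ℕ) → EuclideanSpace ℝ (Fin n)),
      (∀ z, F z = ∑ s ∈ Lifting.exponents n mF, Lifting.monomialFun s z • w s) →
      ∀ᵐ ω ∂P, ∀ (S : Finset (Fin n →₀ ℕ)) (hS : Lifting.exponents n mF ⊆ S)
        (hlin : ∀ j, Finsupp.single j 1 ∈ S) (K : ℕ), S.card ≤ K →
        ∀ (j : Fin n) (s : Fin n →₀ ℕ) (hs : s ∈ Lifting.exponents n mF),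
          Tendsto
            (fun T : ℝ => Lifting.generatorEstimate (fun i : S => ρ (Lifting.monomialFun (i : Fin n →₀ ℕ))) T
              (fun k : Fin K => x k ω) (fun k : Fin K => φ T (x k ω))
              ⟨s, hS hs⟩ ⟨Finsupp.single j 1, hlin j⟩)
            (𝓝[>] 0) (𝓝 (w s j))) := by
  refine ⟨fun g G l hg hG hlin hd hl => ?_, fun mF w hw => ?_⟩
  · exact Lifting.ae_tendsto_fieldEstimate hF hφ hns hXc hXpos hXinv hρ hxm hxu hxi
      (fun k z hz => (hg k z hz).differentiableAt (by simp)) hG hlin hd hl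
  · exact Lifting.ae_tendsto_generatorEstimate_monomialFun hφ hns hXc hXinv hρ hxm hxu hxi hw
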